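/- Let $n,m\ge 1$ be integers, let $1\le k\le\min\{n,m\}$, and let $\Sigma_0\in\mathbb{R}^{n\times n}$ be symmetric with $n$ distinct positive eigenvalues. Let $\Sigma_0=\Omega\Lambda\Omega^\top$ be a spectral decomposition with $\Omega$ orthogonal and $\Lambda=\operatorname{diag}(\lambda_1,\dots,\lambda_n)$, $\lambda_1>\dots>\lambda_n>0$. For $W\in\mathbb{R}^{n\times m}$ define the Bures–Wasserstein loss $$L^1(W)=\operatorname{tr}\Big(WW^\top+\Sigma_0-2\big(\Sigma_0^{1/2}WW^\top\Sigma_0^{1/2}\big)^{1/2}\Big),$$ where $A^{1/2}$ is the positive semidefinite square root of a positive semidefinite matrix $A$. Let $\mathcal{M}(k)$ be the manifold of real $n\times m$ matrices of rank exactly $k$, and $\mathcal{M}(\leqslant k)$ the set of those of rank at most $k$. For $J\subseteq[n]=\{1,\dots,n\}$ with $|J|=k$, let $\Omega_J\in\mathbb{R}^{n\times k}$ consist of the columns of $\Omega$ with index in $J$ and $\bar\Lambda_J\in\mathbb{R}^{k\times k}$ of the rows and columns of $\Lambda$ with index in $J$ (both in increasing order of the index). Then the following hold. 1. The restriction $L^1|_{\mathcal{M}(k)}$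 is differentiable, and $W$ is a critical point of it (that is, $W\in\mathcal{M}(k)$ and the differential of $L^1|_{\mathcal{M}(k)}$ at $W$ vanishes on the tangent space of $\mathcal{M}(k)$ at $W$) if and only if $$W=\Omega_J\,\bar\Lambda_J^{1/2}\,V^\top$$ for some $J\subseteq[n]$ with $|J|=k$ and some $V\in\mathbb{R}^{m\times k}$ with $V^\top V=I_k$. 2. The minimum of $L^1$ over $\mathcal{M}(\leqslant k)$ is attained precisely when $J=[k]$: a matrix $\Omega_J\bar\Lambda_J^{1/2}V^\top$ as in 1 is a minimizer of $L^1$ over $\mathcal{M}(\leqslant k)$ if and only if $J=[k]$, and the minimizers of $L^1$ over $\mathcal{M}(\leqslant k)$ are exactly the matrices $\Omega_{[k]}\bar\Lambda_{[k]}^{1/2}V^\top$ with $V\in\mathbb{R}^{m\times k}$, $V^\top V=I_k$. 3. In particular, the infimum of $L^1$ over $\mathcal{M}(k)$ is attained, and $$\inf_{\mathcal{M}(k)}L^1=\min_{\mathcal{M}(k)}L^1=\min_{\mathcal{M}(\leqslant k)}L^1.$$ -/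

import Mathlib

open scoped MatrixOrder Matrix

noncomputable section

namespace BuresWasserstein

/-- The squared Bures-Wasserstein distance between positive semidefinite matrices; `CFC.sqrt` is the
positive semidefinite square root. -/
def buresSq {n : ℕ} (S S₀ : Matrix (Fin n) (Fin n) ℝ) : ℝ :=
  (S + S₀ - (2 : ℝ) • CFC.sqrt (CFC.sqrt S₀ * S * CFC.sqrt S₀)).trace

/-- The loss in function space, `W ↦ B²(W Wᵀ, Σ₀)`. -/
def lossOne {n m : ℕ} (S₀ : Matrix (Fin n) (Fin n) ℝ) (W : Matrix (Fin n) (Fin m) ℝ) : ℝ :=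
  buresSq (W * Wᵀ) S₀

/-- The real `n × m` matrices of rank exactly `k`. -/
def rankEq (k n m : ℕ) : Set (Matrix (Fin n) (Fin m) ℝ) := {W | W.rank = k}

/-- The real `n × m` matrices of rank at most `k`. -/
def rankLE (k n m : ℕ) : Set (Matrix (Fin n) (Fin m) ℝ) := {W | W.rank ≤ k}

/-- `W` is a critical point of the restriction of `f` to the embedded submanifold `M`: the
restriction is differentiable at `W` and its differential vanishes on the tangent space to `M`
at `W`. (At points of an embedded submanifold, `tangentConeAt` is the tangent space, and the values
there of a derivative within `M` are determined by the restriction of `f` to `M`. No norm has to be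
chosen: derivatives are taken in the topological vector space of matrices.) -/
def IsCriticalPointOn {n m : ℕ} (f : Matrix (Fin n) (Fin m) ℝ → ℝ)
    (M : Set (Matrix (Fin n) (Fin m) ℝ)) (W : Matrix (Fin n) (Fin m) ℝ) : Prop :=
  W ∈ M ∧ ∃ f' : Matrix (Fin n) (Fin m) ℝ →L[ℝ] ℝ,
    HasFDerivWithinAt f f' M W ∧ ∀ H ∈ tangentConeAt ℝ M W, f' H = 0

/-- The columns of `A` with index in `J`, in increasing order. -/
def columns {n k : ℕ} (A : Matrix (Fin n) (Fin n) ℝ) (J : Finset (Fin n)) (hJ : J.card = k) :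
    Matrix (Fin n) (Fin k) ℝ :=
  A.submatrix id (J.orderEmbOfFin hJ)

/-- The rows and columns of `A` with index in `J`, in increasing order. -/
def principal {n k : ℕ} (A : Matrix (Fin n) (Fin n) ℝ) (J : Finset (Fin n)) (hJ : J.card = k) :
    Matrix (Fin k) (Fin k) ℝ :=
  A.submatrix (J.orderEmbOfFin hJ) (J.orderEmbOfFin hJ)

/-- The matrix `Ω_J (Λ_J)^{1/2} Vᵀ`. -/
def candidate {n m k : ℕ} (Ω Λ : Matrix (Fin n) (Fin n) ℝ) (J : Finset (Fin n)) (hJ : J.card = k)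
    (V : Matrix (Fin m) (Fin k) ℝ) : Matrix (Fin n) (Fin m) ℝ :=
  columns Ω J hJ * CFC.sqrt (principal Λ J hJ) * Vᵀ

/-- The set of the first `k` indices. -/
def firstIndices (n k : ℕ) : Finset (Fin n) := Finset.univ.filter fun i => i.val < k

theorem card_firstIndices {n k : ℕ} (h : k ≤ n) : (firstIndices n k).card = k := by
  simp [firstIndices, Fin.card_filter_val_lt, h]

end BuresWasserstein

end

/-!
Write `X = Σ₀^{1/2} W`. Then `L¹(W) = ‖W‖² + tr Σ₀ - 2 ‖X‖_*`, with the nuclear norm `‖X‖_*`.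

If `X₀ = U diag(s) Vᵀ` is a compact singular value decomposition, then near `X₀`, among matrices of
the same rank, `‖X‖_*` lies between `tr((U Vᵀ)ᵀ X)` and half of `‖A‖² + ‖B‖²` for a factorization
`X = A Bᵀ` depending smoothly on `X`. Both bounds have differential `⟨U Vᵀ, ·⟩` at `X₀`, hence so
does the nuclear norm, and the gradient of the loss is `2 (W - Σ₀^{1/2} U Vᵀ)`. This gradient is
itself tangent to the manifold, so at a critical point `W = Σ₀^{1/2} U Vᵀ`; then the range of `U` is
invariant under `Σ₀` and is spanned by `k` of its eigenvectors.

Completing the square gives `L¹(W) = ‖W - Σ₀^{1/2} U Vᵀ‖² + tr Σ₀ - tr(Uᵀ Σ₀ U)`. The last trace is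
`∑ λᵢ xᵢ` with `xᵢ` the diagonal entries of a projection, so that `0 ≤ xᵢ ≤ 1` and `∑ xᵢ ≤ k`; it is
therefore at most `λ₁ + ⋯ + λₖ`, with equality only for the projection onto the top `k`
eigenvectors.
-/

namespace BuresWasserstein

open Matrix

section Frobenius

variable {p q κ : Type*} [Fintype p] [Fintype q]

/-- The squared Frobenius norm, taken as a trace so that no norm on matrices has to be chosen. -/
def frobeniusSq (A : Matrix p q ℝ) : ℝ := (Aᵀ * A).trace

theorem frobeniusSq_nonneg (A : Matrix p q ℝ) : 0 ≤ frobeniusSq A := by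
  simpa [frobeniusSq] using (posSemidef_conjTranspose_mul_self A).trace_nonneg

theorem frobeniusSq_eq_zero_iff {A : Matrix p q ℝ} : frobeniusSq A = 0 ↔ A = 0 := by
  simpa [frobeniusSq] using trace_conjTranspose_mul_self_eq_zero_iff (A := A)

theorem trace_transpose_mul_comm (A B : Matrix p q ℝ) : (Aᵀ * B).trace = (Bᵀ * A).trace := by
  rw [← trace_transpose, transpose_mul, transpose_transpose]

theorem frobeniusSq_sub (A B : Matrix p q ℝ) :
    frobeniusSq (A - B) = frobeniusSq A - 2 * (Bᵀ * A).trace + frobeniusSq B := by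
  simp only [frobeniusSq, transpose_sub, Matrix.sub_mul, Matrix.mul_sub, trace_sub]
  rw [trace_transpose_mul_comm A B]
  ring

variable [Fintype κ] [DecidableEq κ]

theorem frobeniusSq_mul_of_transpose_mul_self {U : Matrix p κ ℝ} (hU : Uᵀ * U = 1)
    (B : Matrix κ q ℝ) : frobeniusSq (U * B) = frobeniusSq B := by
  rw [frobeniusSq, transpose_mul, Matrix.mul_assoc, ← Matrix.mul_assoc Uᵀ, hU, Matrix.one_mul,
    frobeniusSq]

theorem frobeniusSq_transpose_mul_le {U : Matrix p κ ℝ} (hU : Uᵀ * U = 1) (B : Matrix p q ℝ) :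
    frobeniusSq (Uᵀ * B) ≤ frobeniusSq B := by
  have hinner : ((U * (Uᵀ * B))ᵀ * B).trace = frobeniusSq (Uᵀ * B) := by
    rw [transpose_mul, Matrix.mul_assoc, frobeniusSq]
  have hresidual := frobeniusSq_nonneg (B - U * (Uᵀ * B))
  rw [frobeniusSq_sub, frobeniusSq_mul_of_transpose_mul_self hU, hinner] at hresidual
  linarith

theorem two_mul_trace_mul_transpose_le {ι : Type*} [Fintype ι] {U : Matrix p κ ℝ}
    {V : Matrix q κ ℝ} (hU : Uᵀ * U = 1) (hV : Vᵀ * V = 1) (B : Matrix p ι ℝ) (D : Matrix q ι ℝ) :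
    2 * ((U * Vᵀ)ᵀ * (B * Dᵀ)).trace ≤ frobeniusSq B + frobeniusSq D := by
  have hcyclic : ((U * Vᵀ)ᵀ * (B * Dᵀ)).trace = ((Vᵀ * D)ᵀ * (Uᵀ * B)).trace := by
    rw [← Matrix.mul_assoc, trace_mul_comm]
    simp only [transpose_mul, transpose_transpose, Matrix.mul_assoc]
  have hdiff := frobeniusSq_nonneg (Uᵀ * B - Vᵀ * D)
  rw [frobeniusSq_sub, ← hcyclic] at hdiff
  linarith [frobeniusSq_transpose_mul_le hU B, frobeniusSq_transpose_mul_le hV D]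

end Frobenius

section ConjDiagonal

variable {p q : Type*} [Fintype q] [DecidableEq q] {U : Matrix p q ℝ}

theorem conj_diagonal_mul_conj_diagonal [Fintype p] (hU : Uᵀ * U = 1) (s t : q → ℝ) :
    U * diagonal s * Uᵀ * (U * diagonal t * Uᵀ) = U * diagonal (fun i => s i * t i) * Uᵀ := by
  calc U * diagonal s * Uᵀ * (U * diagonal t * Uᵀ)
      = U * diagonal s * (Uᵀ * U) * diagonal t * Uᵀ := by simp only [Matrix.mul_assoc]
    _ = U * diagonal (fun i => s i * t i) * Uᵀ := by
      rw [hU, Matrix.mul_one, Matrix.mul_assoc U, diagonal_mul_diagonal]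

theorem trace_conj_diagonal [Fintype p] (hU : Uᵀ * U = 1) (s : q → ℝ) :
    (U * diagonal s * Uᵀ).trace = ∑ i, s i := by
  rw [trace_mul_comm, ← Matrix.mul_assoc, hU, Matrix.one_mul, trace_diagonal]

theorem sqrt_conj_diagonal [Fintype p] [DecidableEq p] (hU : Uᵀ * U = 1) {s : q → ℝ}
    (hs : ∀ i, 0 ≤ s i) :
    CFC.sqrt (U * diagonal s * Uᵀ) = U * diagonal (fun i => √(s i)) * Uᵀ := by
  have hpsd : (U * diagonal (fun i => √(s i)) * Uᵀ).PosSemidef := by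
    simpa using (PosSemidef.diagonal (d := fun i => √(s i))
      fun i => Real.sqrt_nonneg _).mul_mul_conjTranspose_same U
  refine CFC.sqrt_unique ?_ (nonneg_iff_posSemidef.mpr hpsd)
  simp only [conj_diagonal_mul_conj_diagonal hU, Real.mul_self_sqrt (hs _)]

theorem sqrt_diagonal {s : q → ℝ} (hs : ∀ i, 0 ≤ s i) :
    CFC.sqrt (diagonal s) = diagonal fun i => √(s i) := by
  simpa using sqrt_conj_diagonal (U := (1 : Matrix q q ℝ)) (by simp) hs

theorem transpose_mul_self_mul [Fintype p] {r : Type*} [DecidableEq r] {A : Matrix q r ℝ}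
    (hU : Uᵀ * U = 1) (hA : Aᵀ * A = 1) : (U * A)ᵀ * (U * A) = 1 := by
  rw [transpose_mul, Matrix.mul_assoc, ← Matrix.mul_assoc Uᵀ, hU, Matrix.one_mul, hA]

end ConjDiagonal

section ColumnSelection

variable {p q κ : Type*} [DecidableEq q] [DecidableEq κ] {g : κ → q}

theorem submatrix_transpose_mul_submatrix [Fintype p] {U : Matrix p q ℝ} (hU : Uᵀ * U = 1)
    (hg : Function.Injective g) : (U.submatrix id g)ᵀ * U.submatrix id g = 1 := by
  rw [transpose_submatrix, ← submatrix_mul _ _ _ _ _ Function.bijective_id, hU, submatrix_one _ hg]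

theorem conj_diagonal_mul_submatrix [Fintype p] [Fintype q] [Fintype κ] {U : Matrix p q ℝ}
    (hU : Uᵀ * U = 1) (d : q → ℝ) (g : κ → q) :
    U * diagonal d * Uᵀ * U.submatrix id g = U.submatrix id g * diagonal (d ∘ g) := by
  have hselect : Uᵀ * U.submatrix id g = (1 : Matrix q q ℝ).submatrix id g := by
    rw [← hU]; rfl
  rw [Matrix.mul_assoc, hselect]
  ext a i
  simp [mul_apply, diagonal_apply, one_apply]

theorem submatrix_conj_diagonal [Fintype q] [Fintype κ] (hg : Function.Injective g)
    (U : Matrix p q ℝ) (d : q → ℝ) :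
    U.submatrix id g * diagonal (d ∘ g) * (U.submatrix id g)ᵀ
      = U * diagonal ((Set.range g).indicator d) * Uᵀ := by
  ext a b
  rw [mul_apply, mul_apply]
  simp only [mul_diagonal, transpose_apply, submatrix_apply, id, Function.comp_apply]
  refine Fintype.sum_of_injective g hg _ _ (fun j hj => ?_) fun i => ?_
  · rw [Set.indicator_of_notMem hj, mul_zero, zero_mul]
  · rw [Set.indicator_of_mem (Set.mem_range_self i)]

end ColumnSelection

section CompactSVD

variable {p q ι : Type*} [Fintype ι] [DecidableEq ι]

/-- A compact singular value decomposition `X = U diag(s) Vᵀ`: only the positive singular values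
are listed, so the index type `ι` has as many elements as the rank of `X`. -/
structure IsCompactSVD [Fintype p] [Fintype q] (X : Matrix p q ℝ) (U : Matrix p ι ℝ) (s : ι → ℝ)
    (V : Matrix q ι ℝ) : Prop where
  left_orthonormal : Uᵀ * U = 1
  right_orthonormal : Vᵀ * V = 1
  pos : ∀ i, 0 < s i
  eq : X = U * diagonal s * Vᵀ

theorem diagonal_inv_mul_diagonal {s : ι → ℝ} (hs : ∀ i, s i ≠ 0) :
    diagonal (fun i => (s i)⁻¹) * diagonal s = 1 := by
  simp only [diagonal_mul_diagonal, inv_mul_cancel₀ (hs _), diagonal_one]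

theorem diagonal_mul_diagonal_inv {s : ι → ℝ} (hs : ∀ i, s i ≠ 0) :
    diagonal s * diagonal (fun i => (s i)⁻¹) = 1 :=
  mul_eq_one_comm.mp (diagonal_inv_mul_diagonal hs)

theorem isUnit_diagonal_of_pos {s : ι → ℝ} (hs : ∀ i, 0 < s i) : IsUnit (diagonal s) :=
  .of_mul_eq_one _ (diagonal_mul_diagonal_inv fun i => (hs i).ne')

variable [Fintype p] [Fintype q] {X : Matrix p q ℝ} {U : Matrix p ι ℝ} {s : ι → ℝ}
  {V : Matrix q ι ℝ}

namespace IsCompactSVD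

theorem mul_transpose_eq (h : IsCompactSVD X U s V) :
    X * Xᵀ = U * diagonal (fun i => s i * s i) * Uᵀ := by
  calc X * Xᵀ = U * diagonal s * (Vᵀ * V) * diagonal s * Uᵀ := by
        rw [h.eq]; simp [Matrix.mul_assoc]
    _ = U * diagonal (fun i => s i * s i) * Uᵀ := by
      rw [h.right_orthonormal, Matrix.mul_one, Matrix.mul_assoc U, diagonal_mul_diagonal]

theorem transpose_mul_eq (h : IsCompactSVD X U s V) : Uᵀ * X = diagonal s * Vᵀ := by
  rw [h.eq, Matrix.mul_assoc, ← Matrix.mul_assoc, h.left_orthonormal, Matrix.one_mul]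

theorem transpose_mul_mul_eq (h : IsCompactSVD X U s V) : Uᵀ * X * V = diagonal s := by
  rw [h.transpose_mul_eq, Matrix.mul_assoc, h.right_orthonormal, Matrix.mul_one]

theorem trace_transpose_mul (h : IsCompactSVD X U s V) : ((U * Vᵀ)ᵀ * X).trace = ∑ i, s i := by
  rw [transpose_mul, transpose_transpose, Matrix.mul_assoc, trace_mul_comm,
    h.transpose_mul_mul_eq, trace_diagonal]

theorem right_eq (h : IsCompactSVD X U s V) : Vᵀ = diagonal (fun i => (s i)⁻¹) * (Uᵀ * X) := by
  rw [h.transpose_mul_eq, ← Matrix.mul_assoc, diagonal_inv_mul_diagonal fun i => (h.pos i).ne',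
    Matrix.one_mul]

theorem rank_eq (h : IsCompactSVD X U s V) : X.rank = Fintype.card ι := by
  apply le_antisymm
  · rw [h.eq]
    exact (rank_mul_le_right _ _).trans (rank_le_card_height _)
  · have hr : (diagonal s).rank = Fintype.card ι := by
      rw [rank_diagonal]
      simp [(h.pos _).ne']
    rw [← hr, ← h.transpose_mul_mul_eq]
    exact (rank_mul_le_left _ _).trans (rank_mul_le_right _ _)

end IsCompactSVD

theorem mul_transpose_mul_eq_of_mul_transpose_eq {C : Matrix ι p ℝ} (hU : Uᵀ * U = 1)
    (hX : X * Xᵀ = U * C) : U * (Uᵀ * X) = X := by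
  classical
  have hfix : U * (Uᵀ * (X * Xᵀ)) = X * Xᵀ := by
    rw [hX, ← Matrix.mul_assoc Uᵀ, hU, Matrix.one_mul]
  have hgram : (U * (Uᵀ * X) - X) * (U * (Uᵀ * X) - X)ᴴ
      = (U * (Uᵀ * (X * Xᵀ)) - X * Xᵀ) * (U * Uᵀ - 1) := by
    simp [Matrix.sub_mul, Matrix.mul_sub, Matrix.mul_assoc]
  rw [hfix, sub_self, Matrix.zero_mul, self_mul_conjTranspose_eq_zero] at hgram
  exact sub_eq_zero.mp hgram

theorem isCompactSVD_of_mul_transpose_eq (hU : Uᵀ * U = 1) (hs : ∀ i, 0 < s i)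
    (hX : X * Xᵀ = U * diagonal (fun i => s i * s i) * Uᵀ) :
    IsCompactSVD X U s (Xᵀ * U * diagonal fun i => (s i)⁻¹) := by
  set S := diagonal s with hS
  set T := diagonal fun i => (s i)⁻¹ with hT
  have hTt : Tᵀ = T := diagonal_transpose _
  have hTS : T * S = 1 := diagonal_inv_mul_diagonal fun i => (hs i).ne'
  have hST : S * T = 1 := diagonal_mul_diagonal_inv fun i => (hs i).ne'
  rw [← diagonal_mul_diagonal] at hX
  refine ⟨hU, ?_, hs, ?_⟩
  · calc (Xᵀ * U * T)ᵀ * (Xᵀ * U * T) = T * Uᵀ * (X * Xᵀ) * U * T := by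
          simp [Matrix.mul_assoc, hTt]
      _ = T * (Uᵀ * U) * S * S * (Uᵀ * U) * T := by rw [hX]; simp only [Matrix.mul_assoc, hS]
      _ = (T * S) * (S * T) := by rw [hU]; simp only [Matrix.mul_one, Matrix.mul_assoc]
      _ = 1 := by rw [hTS, hST, Matrix.mul_one]
  · calc X = U * (Uᵀ * X) :=
          (mul_transpose_mul_eq_of_mul_transpose_eq hU (hX.trans (Matrix.mul_assoc _ _ _))).symm
      _ = U * (S * T) * (Uᵀ * X) := by rw [hST, Matrix.mul_one]
      _ = U * S * (Xᵀ * U * T)ᵀ := by simp [Matrix.mul_assoc, hTt]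

theorem exists_orthogonal_conj_diagonal [DecidableEq p] {S : Matrix p p ℝ} (hS : S.PosSemidef) :
    ∃ (E : Matrix p p ℝ) (e : p → ℝ), Eᵀ * E = 1 ∧ (∀ i, 0 ≤ e i) ∧
      S = E * diagonal e * Eᵀ ∧ S.rank = Fintype.card {i // e i ≠ 0} := by
  have hS' := hS.isHermitian
  refine ⟨hS'.eigenvectorUnitary, hS'.eigenvalues, ?_, hS.eigenvalues_nonneg, ?_,
    hS'.rank_eq_card_non_zero_eigs⟩
  · simpa [star_eq_conjTranspose] using Unitary.coe_star_mul_self hS'.eigenvectorUnitary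
  · simpa [Unitary.conjStarAlgAut_apply, star_eq_conjTranspose, Function.comp_def] using
      hS'.spectral_theorem

theorem exists_isCompactSVD {k : ℕ} (hX : X.rank = k) :
    ∃ (U : Matrix p (Fin k) ℝ) (s : Fin k → ℝ) (V : Matrix q (Fin k) ℝ), IsCompactSVD X U s V := by
  classical
  have hpsd : (X * Xᵀ).PosSemidef := by simpa using posSemidef_self_mul_conjTranspose X
  obtain ⟨E, e, hE, he, hspec, hrank⟩ := exists_orthogonal_conj_diagonal hpsd
  rw [rank_self_mul_transpose, hX] at hrank
  let support : Fin k ≃ {i // e i ≠ 0} := (Fintype.equivFinOfCardEq hrank.symm).symm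
  let g : Fin k → p := fun i => support i
  have hg : Function.Injective g := Subtype.val_injective.comp support.injective
  have hindicator : (Set.range g).indicator e = e := by
    refine Set.indicator_eq_self.mpr fun i hi => ⟨support.symm ⟨i, hi⟩, ?_⟩
    simp [g]
  refine ⟨E.submatrix id g, fun i => √(e (g i)), _, isCompactSVD_of_mul_transpose_eq
    (submatrix_transpose_mul_submatrix hE hg)
    (fun i => Real.sqrt_pos.mpr ((he _).lt_of_ne' (support i).2)) ?_⟩
  simp only [Real.mul_self_sqrt (he _)]
  rw [hspec, ← hindicator, ← submatrix_conj_diagonal hg, hindicator, Function.comp_def]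

end CompactSVD

section NuclearNorm

variable {p q ι : Type*} [Fintype p] [DecidableEq p] [Fintype q] [Fintype ι]

/-- The nuclear norm `tr (X Xᵀ)^{1/2}`, the sum of the singular values of `X`. -/
noncomputable def nuclearNorm (X : Matrix p q ℝ) : ℝ := (CFC.sqrt (X * Xᵀ)).trace

theorem IsCompactSVD.nuclearNorm_eq [DecidableEq ι] {X : Matrix p q ℝ} {U : Matrix p ι ℝ}
    {s : ι → ℝ} {V : Matrix q ι ℝ} (h : IsCompactSVD X U s V) : nuclearNorm X = ∑ i, s i := by
  rw [nuclearNorm, h.mul_transpose_eq,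
    sqrt_conj_diagonal h.left_orthonormal fun i => mul_self_nonneg _,
    trace_conj_diagonal h.left_orthonormal]
  simp only [Real.sqrt_mul_self (h.pos _).le]

theorem two_mul_nuclearNorm_mul_transpose_le (B : Matrix p ι ℝ) (D : Matrix q ι ℝ) :
    2 * nuclearNorm (B * Dᵀ) ≤ frobeniusSq B + frobeniusSq D := by
  obtain ⟨U, s, V, h⟩ := exists_isCompactSVD (X := B * Dᵀ) rfl
  rw [h.nuclearNorm_eq, ← h.trace_transpose_mul]
  exact two_mul_trace_mul_transpose_le h.left_orthonormal h.right_orthonormal B D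

theorem frobeniusSq_mul_diagonal_sqrt [DecidableEq ι] {U : Matrix q ι ℝ} (hU : Uᵀ * U = 1)
    {s : ι → ℝ} (hs : ∀ i, 0 ≤ s i) :
    frobeniusSq (U * diagonal fun i => √(s i)) = ∑ i, s i := by
  rw [frobeniusSq_mul_of_transpose_mul_self hU, frobeniusSq, diagonal_transpose,
    diagonal_mul_diagonal, trace_diagonal]
  simp only [Real.mul_self_sqrt (hs _)]

theorem trace_transpose_mul_le_nuclearNorm [DecidableEq ι] {U : Matrix p ι ℝ} {V : Matrix q ι ℝ}
    (hU : Uᵀ * U = 1) (hV : Vᵀ * V = 1) (X : Matrix p q ℝ) :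
    ((U * Vᵀ)ᵀ * X).trace ≤ nuclearNorm X := by
  obtain ⟨U', s, V', h⟩ := exists_isCompactSVD (X := X) rfl
  have hs : ∀ i, 0 ≤ s i := fun i => (h.pos i).le
  set R := diagonal fun i => √(s i) with hR
  have hRt : Rᵀ = R := diagonal_transpose _
  have hbalanced : X = U' * R * (V' * R)ᵀ := by
    calc X = U' * (R * R) * V'ᵀ := by
          simp only [hR, diagonal_mul_diagonal, Real.mul_self_sqrt (hs _), h.eq]
      _ = U' * R * (V' * R)ᵀ := by rw [transpose_mul, hRt]; simp only [Matrix.mul_assoc]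
  have hpairing := two_mul_trace_mul_transpose_le hU hV (U' * R) (V' * R)
  rw [← hbalanced, frobeniusSq_mul_diagonal_sqrt h.left_orthonormal hs,
    frobeniusSq_mul_diagonal_sqrt h.right_orthonormal hs, ← h.nuclearNorm_eq] at hpairing
  linarith

end NuclearNorm

section Calculus

open scoped Topology

variable {E : Type*} [NormedAddCommGroup E] [NormedSpace ℝ E] {x : E} {s : Set E}

theorem hasFDerivAt_of_le_of_eq {g h : E → ℝ} {g' : E →L[ℝ] ℝ} (hg : HasFDerivAt g g' x)
    (hh : DifferentiableAt ℝ h x) (hle : ∀ᶠ y in 𝓝 x, g y ≤ h y) (hx : g x = h x) :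
    HasFDerivAt h g' x := by
  have hmin : IsLocalMin (fun y => h y - g y) x :=
    hle.mono fun y hy => by simpa [hx] using hy
  have hzero := hmin.hasFDerivAt_eq_zero (hh.hasFDerivAt.fun_sub hg)
  rw [← sub_eq_zero.mp hzero]
  exact hh.hasFDerivAt

theorem hasFDerivWithinAt_of_le_of_le {f g h : E → ℝ} {f' : E →L[ℝ] ℝ}
    (hg : HasFDerivAt g f' x) (hh : HasFDerivAt h f' x) (hxs : x ∈ s) (hx : g x = h x)
    (hgf : ∀ᶠ y in 𝓝[s] x, g y ≤ f y) (hfh : ∀ᶠ y in 𝓝[s] x, f y ≤ h y) :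
    HasFDerivWithinAt f f' s x := by
  have hgfx : g x = f x :=
    le_antisymm (hgf.self_of_nhdsWithin hxs) (hx ▸ hfh.self_of_nhdsWithin hxs)
  have hgap : HasFDerivWithinAt (fun y => h y - g y) (0 : E →L[ℝ] ℝ) s x := by
    simpa using (hh.fun_sub hg).hasFDerivWithinAt
  have hdiff : HasFDerivWithinAt (fun y => f y - g y) (0 : E →L[ℝ] ℝ) s x := by
    refine .of_isLittleO (Asymptotics.IsBigO.trans_isLittleO (.of_bound 1 ?_) hgap.isLittleO)
    filter_upwards [hgf, hfh] with y hgy hhy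
    simp only [← hgfx, hx, sub_self, sub_zero, _root_.zero_apply, Real.norm_eq_abs,
      one_mul]
    exact abs_le_abs_of_nonneg (by linarith) (by linarith)
  simpa using hdiff.fun_add hg.hasFDerivWithinAt

section NonsingInv

attribute [local instance] Matrix.linftyOpNormedRing Matrix.linftyOpNormedAlgebra

theorem differentiableAt_nonsing_inv {p : Type*} [Fintype p] [DecidableEq p] {A : Matrix p p ℝ}
    (hA : IsUnit A) : DifferentiableAt ℝ (fun B : Matrix p p ℝ => B⁻¹) A := by
  simp only [nonsing_inv_eq_ringInverse]
  exact differentiableAt_inverse hA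

end NonsingInv

attribute [local instance] Matrix.normedAddCommGroup Matrix.normedSpace

variable {p q r : Type*}

theorem differentiableAt_matrix [Finite q] {F : E → Matrix p q ℝ} :
    DifferentiableAt ℝ F x ↔ ∀ i j, DifferentiableAt ℝ (fun y => F y i j) x :=
  have := Fintype.ofFinite q
  differentiableAt_pi.trans (forall_congr' fun _ => differentiableAt_pi)

@[fun_prop]
theorem differentiableAt_matrix_mul [Fintype q] [Finite r] {F : E → Matrix p q ℝ}
    {G : E → Matrix q r ℝ} (hF : DifferentiableAt ℝ F x) (hG : DifferentiableAt ℝ G x) :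
    DifferentiableAt ℝ (fun y => F y * G y) x := by
  rw [differentiableAt_matrix] at *
  intro i j
  simp only [mul_apply]
  exact .fun_sum fun k _ => (hF i k).mul (hG k j)

@[fun_prop]
theorem differentiableAt_matrix_transpose [Finite p] [Finite q] {F : E → Matrix p q ℝ}
    (hF : DifferentiableAt ℝ F x) :
    DifferentiableAt ℝ (fun y => (F y)ᵀ) x := by
  rw [differentiableAt_matrix] at *
  exact fun i j => hF j i

variable [Fintype p] [Fintype q]

@[fun_prop]
theorem differentiableAt_matrix_trace {F : E → Matrix p p ℝ} (hF : DifferentiableAt ℝ F x) :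
    DifferentiableAt ℝ (fun y => (F y).trace) x := by
  rw [differentiableAt_matrix] at hF
  simp only [trace, diag_apply]
  exact .fun_sum fun k _ => hF k k

@[fun_prop]
theorem differentiableAt_matrix_inv [DecidableEq p] {F : E → Matrix p p ℝ}
    (hF : DifferentiableAt ℝ F x) (hx : IsUnit (F x)) :
    DifferentiableAt ℝ (fun y => (F y)⁻¹) x :=
  (differentiableAt_nonsing_inv hx).comp x hF

@[fun_prop]
theorem differentiableAt_frobeniusSq {F : E → Matrix p q ℝ} (hF : DifferentiableAt ℝ F x) :
    DifferentiableAt ℝ (fun y => frobeniusSq (F y)) x := by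
  unfold frobeniusSq
  fun_prop

/-- The continuous functional `H ↦ tr (Gᵀ H)` that a gradient `G` represents. -/
noncomputable def frobeniusDual (G : Matrix p q ℝ) : Matrix p q ℝ →L[ℝ] ℝ :=
  LinearMap.toContinuousLinearMap (traceLinearMap q ℝ ℝ ∘ₗ mulLeftLinearMap q ℝ Gᵀ)

@[simp]
theorem frobeniusDual_apply (G H : Matrix p q ℝ) : frobeniusDual G H = (Gᵀ * H).trace := rfl

theorem hasFDerivAt_frobeniusSq (W : Matrix p q ℝ) :
    HasFDerivAt frobeniusSq (frobeniusDual ((2 : ℝ) • W)) W := by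
  have htangent : HasFDerivAt (fun Y => frobeniusDual ((2 : ℝ) • W) Y - frobeniusSq W)
      (frobeniusDual ((2 : ℝ) • W)) W := (frobeniusDual _).hasFDerivAt.sub_const _
  refine hasFDerivAt_of_le_of_eq htangent (by fun_prop) (.of_forall fun Y => ?_) ?_
  · have hgap := frobeniusSq_nonneg (Y - W)
    rw [frobeniusSq_sub] at hgap
    simp only [frobeniusDual_apply, transpose_smul, smul_mul, trace_smul, smul_eq_mul]
    linarith
  · simp only [frobeniusDual_apply, transpose_smul, smul_mul, trace_smul, smul_eq_mul, frobeniusSq]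
    ring

end Calculus

section NuclearNormDerivative

variable {p q ι : Type*} [Fintype ι] [DecidableEq ι] {U : Matrix p ι ℝ} {s : ι → ℝ}
  {V : Matrix q ι ℝ}

theorem mul_diagonal_inv_sqrt_mul_diagonal_sqrt_mul (hs : ∀ i, 0 < s i) (B : Matrix p ι ℝ)
    (C : Matrix ι q ℝ) :
    B * (diagonal fun i => (√(s i))⁻¹) * ((diagonal fun i => √(s i)) * C)ᵀᵀ = B * C := by
  rw [transpose_transpose, Matrix.mul_assoc, ← Matrix.mul_assoc (diagonal _),
    diagonal_inv_mul_diagonal fun i => (Real.sqrt_pos.mpr (hs i)).ne', Matrix.one_mul]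

variable [Fintype p] [Fintype q]

theorem eq_mul_inv_mul_of_rank_eq_card {X : Matrix p q ℝ}
    (hX : X.rank = Fintype.card ι) (hN : IsUnit (Uᵀ * X * V)) :
    X = X * V * ((Uᵀ * X * V)⁻¹ * (Uᵀ * X)) := by
  classical
  have hrank : X.rank ≤ (X * V).rank := by
    rw [hX, ← rank_of_isUnit _ hN, Matrix.mul_assoc]
    exact rank_mul_le_right _ _
  have hrange : LinearMap.range (X * V).mulVecLin = LinearMap.range X.mulVecLin :=
    Submodule.eq_of_le_of_finrank_le
      (by rw [mulVecLin_mul]; exact LinearMap.range_comp_le_range _ _) hrank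
  have hcol : ∀ j, ∃ z, (X * V) *ᵥ z = X.col j := fun j => by
    have hj : X.col j ∈ LinearMap.range (X * V).mulVecLin := by
      rw [hrange]; exact ⟨Pi.single j 1, by simp⟩
    exact hj
  choose z hz using hcol
  have hXZ : X = X * V * (of z)ᵀ := ext fun i j => (congrFun (hz j) i).symm
  have hUXZ : Uᵀ * X = Uᵀ * X * V * (of z)ᵀ := by
    conv_lhs => rw [hXZ]
    simp only [Matrix.mul_assoc]
  have hZ : (Uᵀ * X * V)⁻¹ * (Uᵀ * X) = (of z)ᵀ :=
    (congrArg _ hUXZ).trans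
      (nonsing_inv_mul_cancel_left _ _ ((isUnit_iff_isUnit_det _).mp hN))
  rwa [hZ]

/-- The upper bound on `nuclearNorm Y` given by the factors `Y V diag(√s)⁻¹` and
`diag(√s) N⁻¹ Uᵀ Y` with `N = Uᵀ Y V`. Their product is `Y` as long as `N` is invertible and `Y` has
rank `card ι`, and they are balanced when `Y = U diag(s) Vᵀ`. -/
noncomputable def factorBound (U : Matrix p ι ℝ) (s : ι → ℝ) (V : Matrix q ι ℝ)
    (Y : Matrix p q ℝ) : ℝ :=
  (frobeniusSq (Y * V * diagonal fun i => (√(s i))⁻¹)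
    + frobeniusSq ((diagonal fun i => √(s i)) * ((Uᵀ * Y * V)⁻¹ * (Uᵀ * Y)))ᵀ) / 2

theorem nuclearNorm_le_factorBound [DecidableEq p] (hs : ∀ i, 0 < s i) {Y : Matrix p q ℝ}
    (hY : Y.rank = Fintype.card ι) (hN : IsUnit (Uᵀ * Y * V)) :
    nuclearNorm Y ≤ factorBound U s V Y := by
  have hbound := two_mul_nuclearNorm_mul_transpose_le (Y * V * diagonal fun i => (√(s i))⁻¹)
    ((diagonal fun i => √(s i)) * ((Uᵀ * Y * V)⁻¹ * (Uᵀ * Y)))ᵀ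
  rw [mul_diagonal_inv_sqrt_mul_diagonal_sqrt_mul hs,
    ← eq_mul_inv_mul_of_rank_eq_card hY hN] at hbound
  rw [factorBound]
  linarith

theorem trace_transpose_mul_le_factorBound (hU : Uᵀ * U = 1) (hV : Vᵀ * V = 1) (hs : ∀ i, 0 < s i)
    {Y : Matrix p q ℝ} (hN : IsUnit (Uᵀ * Y * V)) :
    ((U * Vᵀ)ᵀ * Y).trace ≤ factorBound U s V Y := by
  have hbound := two_mul_trace_mul_transpose_le hU hV (Y * V * diagonal fun i => (√(s i))⁻¹)
    ((diagonal fun i => √(s i)) * ((Uᵀ * Y * V)⁻¹ * (Uᵀ * Y)))ᵀ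
  have hpairing : ((U * Vᵀ)ᵀ * (Y * V * ((Uᵀ * Y * V)⁻¹ * (Uᵀ * Y)))).trace
      = ((U * Vᵀ)ᵀ * Y).trace := by
    calc ((U * Vᵀ)ᵀ * (Y * V * ((Uᵀ * Y * V)⁻¹ * (Uᵀ * Y)))).trace
        = (V * ((Uᵀ * Y * V) * ((Uᵀ * Y * V)⁻¹ * (Uᵀ * Y)))).trace := by
          simp only [transpose_mul, transpose_transpose, Matrix.mul_assoc]
      _ = (V * (Uᵀ * Y)).trace := by
          rw [mul_nonsing_inv_cancel_left _ _ ((isUnit_iff_isUnit_det _).mp hN)]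
      _ = ((U * Vᵀ)ᵀ * Y).trace := by
          rw [transpose_mul, transpose_transpose, Matrix.mul_assoc]
  rw [mul_diagonal_inv_sqrt_mul_diagonal_sqrt_mul hs, hpairing] at hbound
  rw [factorBound]
  linarith

theorem IsCompactSVD.factorBound_eq {X : Matrix p q ℝ} (h : IsCompactSVD X U s V) :
    factorBound U s V X = ∑ i, s i := by
  have hs : ∀ i, 0 ≤ s i := fun i => (h.pos i).le
  have hleft : X * V * (diagonal fun i => (√(s i))⁻¹) = U * diagonal fun i => √(s i) := by
    rw [h.eq, Matrix.mul_assoc _ Vᵀ, h.right_orthonormal, Matrix.mul_one, Matrix.mul_assoc,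
      diagonal_mul_diagonal]
    simp only [← div_eq_mul_inv, Real.div_sqrt]
  have hright : (Uᵀ * X * V)⁻¹ * (Uᵀ * X) = Vᵀ := by
    rw [h.transpose_mul_mul_eq, h.transpose_mul_eq,
      nonsing_inv_mul_cancel_left _ _ ((isUnit_iff_isUnit_det _).mp (isUnit_diagonal_of_pos h.pos))]
  rw [factorBound, hleft, hright, transpose_mul, transpose_transpose, diagonal_transpose,
    frobeniusSq_mul_diagonal_sqrt h.left_orthonormal hs,
    frobeniusSq_mul_diagonal_sqrt h.right_orthonormal hs, add_self_div_two]

section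

attribute [local instance] Matrix.normedAddCommGroup Matrix.normedSpace

theorem differentiableAt_factorBound {X : Matrix p q ℝ} (hN : IsUnit (Uᵀ * X * V)) :
    DifferentiableAt ℝ (factorBound U s V) X := by
  unfold factorBound
  fun_prop (disch := assumption)

open scoped Topology in
theorem eventually_isUnit_transpose_mul_mul {X : Matrix p q ℝ} (hN : IsUnit (Uᵀ * X * V)) :
    ∀ᶠ Y in 𝓝 X, IsUnit (Uᵀ * Y * V) := by
  have hdet : Continuous fun Y : Matrix p q ℝ => (Uᵀ * Y * V).det := by fun_prop
  simp only [isUnit_iff_isUnit_det, isUnit_iff_ne_zero] at hN ⊢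
  exact hdet.continuousAt.eventually_ne hN

theorem IsCompactSVD.hasFDerivWithinAt_nuclearNorm [DecidableEq p] {X : Matrix p q ℝ}
    (h : IsCompactSVD X U s V) :
    HasFDerivWithinAt nuclearNorm (frobeniusDual (U * Vᵀ)) {Y | Y.rank = Fintype.card ι} X := by
  have hlower : HasFDerivAt (fun Y => ((U * Vᵀ)ᵀ * Y).trace) (frobeniusDual (U * Vᵀ)) X :=
    (frobeniusDual (U * Vᵀ)).hasFDerivAt
  have htouch : ((U * Vᵀ)ᵀ * X).trace = factorBound U s V X :=
    h.trace_transpose_mul.trans h.factorBound_eq.symm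
  have hunit : IsUnit (Uᵀ * X * V) := by
    rw [h.transpose_mul_mul_eq]; exact isUnit_diagonal_of_pos h.pos
  have hnear := eventually_isUnit_transpose_mul_mul hunit
  have hupper : HasFDerivAt (factorBound U s V) (frobeniusDual (U * Vᵀ)) X :=
    hasFDerivAt_of_le_of_eq hlower (differentiableAt_factorBound hunit)
      (hnear.mono fun Y hY =>
        trace_transpose_mul_le_factorBound h.left_orthonormal h.right_orthonormal h.pos hY) htouch
  refine hasFDerivWithinAt_of_le_of_le hlower hupper h.rank_eq htouch
    (.of_forall fun Y => ?_) ?_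
  · exact trace_transpose_mul_le_nuclearNorm h.left_orthonormal h.right_orthonormal Y
  · filter_upwards [self_mem_nhdsWithin, nhdsWithin_le_nhds hnear] with Y hrank hY
    exact nuclearNorm_le_factorBound h.pos hrank hY

end

end NuclearNormDerivative

section TangentCone

attribute [local instance] Matrix.normedAddCommGroup Matrix.normedSpace

open scoped Topology

variable {n m k : ℕ} {W : Matrix (Fin n) (Fin m) ℝ}

theorem add_smul_mul_mem_rankEq (hW : W ∈ rankEq k n m) {P : Matrix (Fin n) (Fin n) ℝ} {t : ℝ}
    (ht : (1 + t • P).det ≠ 0) : W + t • (P * W) ∈ rankEq k n m := by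
  have hfactor : W + t • (P * W) = (1 + t • P) * W := by simp [Matrix.add_mul]
  rw [hfactor, rankEq, Set.mem_ofPred_eq,
    rank_mul_eq_right_of_isUnit_det _ _ (isUnit_iff_ne_zero.mpr ht)]
  exact hW

theorem mul_mem_tangentConeAt_rankEq (hW : W ∈ rankEq k n m) (P : Matrix (Fin n) (Fin n) ℝ) :
    P * W ∈ tangentConeAt ℝ (rankEq k n m) W := by
  have hdet : Continuous fun t : ℝ => (1 + t • P).det := by fun_prop
  have hnear : {t : ℝ | (1 + t • P).det ≠ 0} ∈ 𝓝 (0 : ℝ) :=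
    (isOpen_ne.preimage hdet).mem_nhds (by simp)
  have hcurve : HasFDerivWithinAt (fun t : ℝ => W + t • (P * W))
      ((ContinuousLinearMap.id ℝ ℝ).smulRight (P * W)) {t | (1 + t • P).det ≠ 0} 0 :=
    ((ContinuousLinearMap.id ℝ ℝ).smulRight (P * W)).hasFDerivWithinAt.const_add W
  have hone : (1 : ℝ) ∈ tangentConeAt ℝ {t : ℝ | (1 + t • P).det ≠ 0} 0 := by
    rw [tangentConeAt_of_mem_nhds hnear]; trivial
  have himage : (fun t : ℝ => W + t • (P * W)) '' {t | (1 + t • P).det ≠ 0} ⊆ rankEq k n m :=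
    Set.image_subset_iff.mpr fun t ht => add_smul_mul_mem_rankEq hW ht
  have hvelocity : (1 : ℝ) • (P * W) ∈ tangentConeAt ℝ (rankEq k n m) (W + (0 : ℝ) • (P * W)) :=
    tangentConeAt_mono himage (hcurve.mapsTo_tangent_cone hone)
  rwa [one_smul, zero_smul, add_zero] at hvelocity

end TangentCone

section Sqrt

variable {p : Type*} [Fintype p] [DecidableEq p] {S : Matrix p p ℝ}

theorem transpose_sqrt (S : Matrix p p ℝ) : (CFC.sqrt S)ᵀ = CFC.sqrt S := by
  simpa using (nonneg_iff_posSemidef.mp (CFC.sqrt_nonneg S)).isHermitian.eq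

theorem sqrt_mul_sqrt_self (hS : S.PosSemidef) : CFC.sqrt S * CFC.sqrt S = S :=
  CFC.sqrt_mul_sqrt_self S (nonneg_iff_posSemidef.mpr hS)

theorem rank_sqrt_mul (hS : S.PosDef) {q : Type*} [Fintype q] (W : Matrix p q ℝ) :
    (CFC.sqrt S * W).rank = W.rank := by
  have hunit : IsUnit (CFC.sqrt S) :=
    (CFC.isUnit_sqrt_iff S (nonneg_iff_posSemidef.mpr hS.posSemidef)).mpr hS.isUnit
  exact rank_mul_eq_right_of_isUnit_det _ _ ((isUnit_iff_isUnit_det _).mp hunit)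

end Sqrt

section Loss

variable {n m : ℕ} {S : Matrix (Fin n) (Fin n) ℝ}

theorem lossOne_eq (S : Matrix (Fin n) (Fin n) ℝ) (W : Matrix (Fin n) (Fin m) ℝ) :
    lossOne S W = frobeniusSq W + S.trace - 2 * nuclearNorm (CFC.sqrt S * W) := by
  rw [lossOne, buresSq, trace_sub, trace_add, trace_smul, smul_eq_mul, trace_mul_comm W,
    frobeniusSq, nuclearNorm, transpose_mul, transpose_sqrt]
  simp only [Matrix.mul_assoc]

variable {ι : Type*} [Fintype ι] [DecidableEq ι] {W : Matrix (Fin n) (Fin m) ℝ}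
  {U : Matrix (Fin n) ι ℝ} {s : ι → ℝ} {V : Matrix (Fin m) ι ℝ}

theorem lossOne_eq_frobeniusSq_add (hS : S.PosSemidef) (h : IsCompactSVD (CFC.sqrt S * W) U s V) :
    lossOne S W = frobeniusSq (W - CFC.sqrt S * U * Vᵀ) + S.trace - (Uᵀ * S * U).trace := by
  have hcross : ((CFC.sqrt S * U * Vᵀ)ᵀ * W).trace = nuclearNorm (CFC.sqrt S * W) := by
    rw [h.nuclearNorm_eq, ← h.trace_transpose_mul]
    simp only [transpose_mul, transpose_transpose, transpose_sqrt, Matrix.mul_assoc]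
  have hsq : frobeniusSq (CFC.sqrt S * U * Vᵀ) = (Uᵀ * S * U).trace := by
    calc frobeniusSq (CFC.sqrt S * U * Vᵀ)
        = (V * (Uᵀ * (CFC.sqrt S * CFC.sqrt S) * U * Vᵀ)).trace := by
          simp only [frobeniusSq, transpose_mul, transpose_transpose, transpose_sqrt,
            Matrix.mul_assoc]
      _ = (Uᵀ * S * U).trace := by
          rw [sqrt_mul_sqrt_self hS, trace_mul_comm, Matrix.mul_assoc, h.right_orthonormal,
            Matrix.mul_one]
  rw [lossOne_eq, frobeniusSq_sub, hcross, hsq]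
  ring

section

attribute [local instance] Matrix.normedAddCommGroup Matrix.normedSpace

theorem hasFDerivWithinAt_lossOne (hS : S.PosDef) (h : IsCompactSVD (CFC.sqrt S * W) U s V) :
    HasFDerivWithinAt (lossOne S) (frobeniusDual ((2 : ℝ) • (W - CFC.sqrt S * U * Vᵀ)))
      (rankEq (Fintype.card ι) n m) W := by
  let leftMul : Matrix (Fin n) (Fin m) ℝ →L[ℝ] Matrix (Fin n) (Fin m) ℝ :=
    LinearMap.toContinuousLinearMap (mulLeftLinearMap (Fin m) ℝ (CFC.sqrt S))
  have hmaps : Set.MapsTo leftMul (rankEq (Fintype.card ι) n m) {Y | Y.rank = Fintype.card ι} :=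
    fun Y hY => (rank_sqrt_mul hS Y).trans hY
  have hnuclear : HasFDerivWithinAt (fun Y => nuclearNorm (CFC.sqrt S * Y))
      (frobeniusDual (U * Vᵀ) ∘L leftMul) (rankEq (Fintype.card ι) n m) W :=
    h.hasFDerivWithinAt_nuclearNorm.comp W leftMul.hasFDerivWithinAt hmaps
  have hfrobenius := (hasFDerivAt_frobeniusSq W).hasFDerivWithinAt
    (s := rankEq (Fintype.card ι) n m)
  rw [funext (lossOne_eq S)]
  refine ((hfrobenius.add_const S.trace).fun_sub (hnuclear.const_mul 2)).congr_fderiv ?_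
  ext H
  change frobeniusDual ((2 : ℝ) • W) H - 2 * frobeniusDual (U * Vᵀ) (CFC.sqrt S * H)
    = frobeniusDual ((2 : ℝ) • (W - CFC.sqrt S * U * Vᵀ)) H
  simp [Matrix.sub_mul, transpose_sqrt, Matrix.mul_assoc, mul_sub]

end

theorem differentiableOn_lossOne (hS : S.PosDef) (k : ℕ) :
    DifferentiableOn ℝ (lossOne S) (rankEq k n m) := by
  intro W hW
  obtain ⟨U, s, V, h⟩ := exists_isCompactSVD ((rank_sqrt_mul hS W).trans hW)
  simpa using (hasFDerivWithinAt_lossOne hS h).differentiableWithinAt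

/-- The gradient `W - S^{1/2} U Vᵀ` is of the form `P W`, hence tangent to `rankEq`; so it has to
vanish at a critical point. -/
theorem isCriticalPointOn_lossOne_iff (hS : S.PosDef) (h : IsCompactSVD (CFC.sqrt S * W) U s V) :
    IsCriticalPointOn (lossOne S) (rankEq (Fintype.card ι) n m) W ↔ W = CFC.sqrt S * U * Vᵀ := by
  have hW : W ∈ rankEq (Fintype.card ι) n m := (rank_sqrt_mul hS W).symm.trans h.rank_eq
  have hderiv := hasFDerivWithinAt_lossOne hS h
  constructor
  · rintro ⟨-, f', hf', hzero⟩
    have htangent := mul_mem_tangentConeAt_rankEq hW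
      (1 - CFC.sqrt S * U * diagonal (fun i => (s i)⁻¹) * Uᵀ * CFC.sqrt S)
    have hgradient : (1 - CFC.sqrt S * U * diagonal (fun i => (s i)⁻¹) * Uᵀ * CFC.sqrt S) * W
        = W - CFC.sqrt S * U * Vᵀ := by
      rw [h.right_eq, Matrix.sub_mul, Matrix.one_mul]
      simp only [Matrix.mul_assoc]
    rw [hgradient] at htangent
    have hsq := (hderiv.unique_on hf' htangent).trans (hzero _ htangent)
    rw [frobeniusDual_apply, transpose_smul, smul_mul, trace_smul, smul_eq_mul, mul_eq_zero,
      or_iff_right two_ne_zero] at hsq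
    exact sub_eq_zero.mp (frobeniusSq_eq_zero_iff.mp hsq)
  · intro hcrit
    refine ⟨hW, _, hderiv, fun H _ => ?_⟩
    simp [sub_eq_zero.mpr hcrit]

theorem commute_mul_transpose_of_eq_sqrt_mul (hS : S.PosSemidef)
    (h : IsCompactSVD (CFC.sqrt S * W) U s V) (hW : W = CFC.sqrt S * U * Vᵀ) :
    Commute S (U * Uᵀ) := by
  have heigen : S * U = U * diagonal s := by
    calc S * U = CFC.sqrt S * W * V := by
          rw [hW, ← Matrix.mul_assoc, ← Matrix.mul_assoc, sqrt_mul_sqrt_self hS, Matrix.mul_assoc,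
            h.right_orthonormal, Matrix.mul_one]
      _ = U * diagonal s := by
          rw [h.eq, Matrix.mul_assoc, h.right_orthonormal, Matrix.mul_one]
  have hSt : Sᵀ = S := by simpa using hS.isHermitian.eq
  calc S * (U * Uᵀ) = U * diagonal s * Uᵀ := by rw [← Matrix.mul_assoc, heigen]
    _ = U * (U * diagonal s)ᵀ := by rw [transpose_mul, diagonal_transpose, Matrix.mul_assoc]
    _ = U * Uᵀ * S := by rw [← heigen, transpose_mul, hSt, Matrix.mul_assoc]

end Loss

section Projection

variable {p ι : Type*} [Fintype p] {M : Matrix p p ℝ}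

theorem isStarProjection_mul_transpose [Fintype ι] [DecidableEq ι] {U : Matrix p ι ℝ}
    (hU : Uᵀ * U = 1) : IsStarProjection (U * Uᵀ) where
  isIdempotentElem := by
    rw [IsIdempotentElem, Matrix.mul_assoc, ← Matrix.mul_assoc Uᵀ, hU, Matrix.one_mul]
  isSelfAdjoint := by
    simp [isSelfAdjoint_iff, star_eq_conjTranspose]

theorem diag_nonneg_of_isStarProjection (hM : IsStarProjection M) (i : p) : 0 ≤ M i i :=
  (nonneg_iff_posSemidef.mp hM.nonneg).diag_nonneg

theorem diag_le_one_of_isStarProjection (hM : IsStarProjection M) (i : p) : M i i ≤ 1 := by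
  classical
  simpa using diag_nonneg_of_isStarProjection hM.one_sub i

theorem diag_eq_sum_sq_of_isStarProjection (hM : IsStarProjection M) (i : p) :
    M i i = ∑ j, M i j ^ 2 := by
  have hsymm : ∀ j, M j i = M i j := fun j => congrFun (congrFun hM.isSelfAdjoint i) j
  conv_lhs => rw [← hM.isIdempotentElem.eq, mul_apply]
  simp only [hsymm, sq]

variable [DecidableEq p]

theorem eq_diagonal_indicator_of_isStarProjection (hM : IsStarProjection M) {J : Finset p}
    (hdiag : M.diag = (J : Set p).indicator 1) : M = diagonal ((J : Set p).indicator 1) := by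
  rw [← hdiag]
  ext i j
  rcases eq_or_ne i j with rfl | hij
  · simp
  · have hsq : M i i ^ 2 = M i i := by
      have hi : M i i = (J : Set p).indicator 1 i := congrFun hdiag i
      rw [hi]
      by_cases hmem : i ∈ J <;> simp [hmem]
    have hrow := diag_eq_sum_sq_of_isStarProjection hM i
    rw [← Finset.add_sum_erase _ _ (Finset.mem_univ i), hsq, left_eq_add,
      Finset.sum_eq_zero_iff_of_nonneg fun _ _ => sq_nonneg _] at hrow
    rw [diagonal_apply_ne _ hij]
    exact pow_eq_zero_iff two_ne_zero |>.mp (hrow j (by simp [hij.symm]))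

theorem exists_eq_diagonal_indicator_of_commute (hM : IsStarProjection M) {d : p → ℝ}
    (hd : Function.Injective d) (hcomm : Commute (diagonal d) M) :
    ∃ J : Finset p, M = diagonal ((J : Set p).indicator 1) := by
  have hoff : M = diagonal M.diag := by
    ext i j
    rcases eq_or_ne i j with rfl | hij
    · simp
    · have hentry : d i * M i j = M i j * d j := by
        simpa using congrFun (congrFun hcomm.eq i) j
      have hzero : (d i - d j) * M i j = 0 := by linear_combination hentry
      rw [diagonal_apply_ne _ hij]
      exact (mul_eq_zero.mp hzero).resolve_left (sub_ne_zero.mpr (hd.ne hij))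
  have hidem : ∀ i, M i i * M i i = M i i := fun i => by
    have hi := congrFun (congrFun hM.isIdempotentElem.eq i) i
    rw [hoff] at hi
    simpa using hi
  refine ⟨Finset.univ.filter fun i => M i i = 1,
    eq_diagonal_indicator_of_isStarProjection hM (funext fun i => ?_)⟩
  rcases IsIdempotentElem.iff_eq_zero_or_one.mp (hidem i) with hi | hi <;> simp [hi]

theorem trace_diagonal_indicator (J : Finset p) :
    (diagonal ((J : Set p).indicator (1 : p → ℝ))).trace = J.card := by
  simp [trace_diagonal, Set.indicator_apply]

end Projection

section Bathtub

variable {ι : Type*} {lam x : ι → ℝ} {J : Finset ι}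

theorem exists_nonneg_threshold [Finite ι] (hpos : ∀ i ∈ J, 0 < lam i)
    (htop : ∀ i ∈ J, ∀ j ∉ J, lam j < lam i) :
    ∃ c, 0 ≤ c ∧ (∀ i ∈ J, c < lam i) ∧ ∀ j ∉ J, lam j < c := by
  classical
  have := Fintype.ofFinite ι
  obtain ⟨c, hlo, hhi⟩ := Order.exists_between_finsets (insert 0 (Jᶜ.image lam)) (J.image lam)
    (by simpa using ⟨hpos, fun j hj i hi => htop i hi j hj⟩)
  refine ⟨c, (hlo 0 (by simp)).le, fun i hi => hhi _ (Finset.mem_image_of_mem _ hi),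
    fun j hj => hlo _ (Finset.mem_insert_of_mem (Finset.mem_image_of_mem _ (by simpa using hj)))⟩

theorem eq_indicator_of_sum_le_sum_mul [Fintype ι] (hpos : ∀ i ∈ J, 0 < lam i)
    (htop : ∀ i ∈ J, ∀ j ∉ J, lam j < lam i) (hx0 : ∀ i, 0 ≤ x i) (hx1 : ∀ i, x i ≤ 1)
    (hcard : ∑ i, x i ≤ J.card) (hle : ∑ i ∈ J, lam i ≤ ∑ i, lam i * x i) :
    x = (J : Set ι).indicator 1 := by
  classical
  obtain ⟨c, hc, habove, hbelow⟩ := exists_nonneg_threshold hpos htop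
  set χ : ι → ℝ := (J : Set ι).indicator 1 with hχ
  have hterm : ∀ i, 0 ≤ (lam i - c) * (χ i - x i) := fun i => by
    by_cases hi : i ∈ J
    · simpa [hχ, hi] using mul_nonneg (sub_nonneg.mpr (habove i hi).le) (sub_nonneg.mpr (hx1 i))
    · simpa [hχ, hi] using mul_nonneg_of_nonpos_of_nonpos (sub_nonpos.mpr (hbelow i hi).le)
        (neg_nonpos.mpr (hx0 i))
  have hsum : ∑ i, (lam i - c) * (χ i - x i)
      = ∑ i ∈ J, lam i - ∑ i, lam i * x i - c * (J.card - ∑ i, x i) := by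
    have hlamχ : ∑ i ∈ J, lam i = ∑ i, lam i * χ i := by simp [hχ, Set.indicator_apply]
    have hcardχ : (J.card : ℝ) = ∑ i, χ i := by simp [hχ, Set.indicator_apply]
    rw [hlamχ, hcardχ, ← Finset.sum_sub_distrib, ← Finset.sum_sub_distrib, Finset.mul_sum,
      ← Finset.sum_sub_distrib]
    exact Finset.sum_congr rfl fun i _ => by ring
  have hzero : ∑ i, (lam i - c) * (χ i - x i) = 0 :=
    le_antisymm (by nlinarith) (Finset.sum_nonneg fun i _ => hterm i)
  rw [Finset.sum_eq_zero_iff_of_nonneg fun i _ => hterm i] at hzero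
  funext i
  have hne : lam i - c ≠ 0 := by
    by_cases hi : i ∈ J
    · exact (sub_pos.mpr (habove i hi)).ne'
    · exact (sub_neg.mpr (hbelow i hi)).ne
  exact (sub_eq_zero.mp ((mul_eq_zero.mp (hzero i (Finset.mem_univ i))).resolve_left hne)).symm

end Bathtub

section OrthogonalConjugation

variable {p ι : Type*} [Fintype p] [DecidableEq p] {Ω : Matrix p p ℝ} {lam : p → ℝ}
  {U : Matrix p ι ℝ}

theorem posDef_conj_diagonal (hΩ : Ωᵀ * Ω = 1) (hpos : ∀ i, 0 < lam i) :
    (Ω * diagonal lam * Ωᵀ).PosDef := by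
  have hunit : IsUnit Ω := .of_mul_eq_one _ (mul_eq_one_comm.mp hΩ)
  simpa [star_eq_conjTranspose] using
    (hunit.posDef_star_right_conjugate_iff).mpr (PosDef.diagonal hpos)

theorem transpose_mul_orthonormal [DecidableEq ι] (hΩ : Ωᵀ * Ω = 1) (hU : Uᵀ * U = 1) :
    (Ωᵀ * U)ᵀ * (Ωᵀ * U) = 1 :=
  transpose_mul_self_mul (by rw [transpose_transpose, mul_eq_one_comm.mp hΩ]) hU

variable [Fintype ι]

theorem trace_transpose_conj_diagonal (Ω : Matrix p p ℝ) (lam : p → ℝ)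
    (U : Matrix p ι ℝ) :
    (Uᵀ * (Ω * diagonal lam * Ωᵀ) * U).trace = ∑ i, lam i * (Ωᵀ * U * (Ωᵀ * U)ᵀ) i i := by
  calc (Uᵀ * (Ω * diagonal lam * Ωᵀ) * U).trace
      = ((Ωᵀ * U)ᵀ * (diagonal lam * (Ωᵀ * U))).trace := by
        simp only [transpose_mul, transpose_transpose, Matrix.mul_assoc]
    _ = (diagonal lam * (Ωᵀ * U * (Ωᵀ * U)ᵀ)).trace := by
        rw [trace_mul_comm, Matrix.mul_assoc]
    _ = ∑ i, lam i * (Ωᵀ * U * (Ωᵀ * U)ᵀ) i i := by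
        simp only [trace, diag_apply, diagonal_mul]

theorem commute_diagonal_of_commute_conj (hΩ : Ωᵀ * Ω = 1)
    (hcomm : Commute (Ω * diagonal lam * Ωᵀ) (U * Uᵀ)) :
    Commute (diagonal lam) (Ωᵀ * U * (Ωᵀ * U)ᵀ) := by
  calc diagonal lam * (Ωᵀ * U * (Ωᵀ * U)ᵀ)
      = Ωᵀ * Ω * diagonal lam * (Ωᵀ * U * (Ωᵀ * U)ᵀ) := by rw [hΩ, Matrix.one_mul]
    _ = Ωᵀ * (Ω * diagonal lam * Ωᵀ * (U * Uᵀ)) * Ω := by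
        simp only [transpose_mul, transpose_transpose, Matrix.mul_assoc]
    _ = Ωᵀ * U * (Ωᵀ * U)ᵀ * diagonal lam * (Ωᵀ * Ω) := by
        rw [hcomm.eq]
        simp only [transpose_mul, transpose_transpose, Matrix.mul_assoc]
    _ = Ωᵀ * U * (Ωᵀ * U)ᵀ * diagonal lam := by rw [hΩ, Matrix.mul_one]

end OrthogonalConjugation

section Candidates

variable {n m k : ℕ} {Ω : Matrix (Fin n) (Fin n) ℝ} {lam : Fin n → ℝ} {J : Finset (Fin n)}

theorem columns_transpose_mul_columns (hΩ : Ωᵀ * Ω = 1) (hJ : J.card = k) :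
    (columns Ω J hJ)ᵀ * columns Ω J hJ = 1 :=
  submatrix_transpose_mul_submatrix hΩ (J.orderEmbOfFin hJ).injective

theorem columns_mul_transpose (Ω : Matrix (Fin n) (Fin n) ℝ) (hJ : J.card = k) :
    columns Ω J hJ * (columns Ω J hJ)ᵀ = Ω * diagonal ((J : Set (Fin n)).indicator 1) * Ωᵀ := by
  have hconj := submatrix_conj_diagonal (J.orderEmbOfFin hJ).injective Ω 1
  rwa [Finset.range_orderEmbOfFin, Pi.one_comp, diagonal_one', Matrix.mul_one] at hconj

theorem transpose_mul_columns_mul_transpose (hΩ : Ωᵀ * Ω = 1) (hJ : J.card = k) :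
    Ωᵀ * columns Ω J hJ * (Ωᵀ * columns Ω J hJ)ᵀ
      = diagonal ((J : Set (Fin n)).indicator 1) := by
  calc Ωᵀ * columns Ω J hJ * (Ωᵀ * columns Ω J hJ)ᵀ
      = Ωᵀ * (columns Ω J hJ * (columns Ω J hJ)ᵀ) * Ω := by
        simp only [transpose_mul, transpose_transpose, Matrix.mul_assoc]
    _ = Ωᵀ * Ω * diagonal ((J : Set (Fin n)).indicator 1) * (Ωᵀ * Ω) := by
        rw [columns_mul_transpose]
        simp only [Matrix.mul_assoc]
    _ = diagonal ((J : Set (Fin n)).indicator 1) := by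
        rw [hΩ, Matrix.one_mul, Matrix.mul_one]

theorem candidate_eq_sqrt_mul (hΩ : Ωᵀ * Ω = 1) (hpos : ∀ i, 0 < lam i) (hJ : J.card = k)
    (V : Matrix (Fin m) (Fin k) ℝ) :
    candidate Ω (diagonal lam) J hJ V
      = CFC.sqrt (Ω * diagonal lam * Ωᵀ) * columns Ω J hJ * Vᵀ := by
  have hprincipal : principal (diagonal lam) J hJ = diagonal fun i => lam (J.orderEmbOfFin hJ i) :=
    submatrix_diagonal _ _ (J.orderEmbOfFin hJ).injective
  rw [candidate, hprincipal, sqrt_diagonal fun i => (hpos _).le,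
    sqrt_conj_diagonal hΩ fun i => (hpos i).le, columns, conj_diagonal_mul_submatrix hΩ]
  rfl

theorem isCompactSVD_sqrt_mul_candidate (hΩ : Ωᵀ * Ω = 1) (hpos : ∀ i, 0 < lam i)
    (hJ : J.card = k) {V : Matrix (Fin m) (Fin k) ℝ} (hV : Vᵀ * V = 1) :
    IsCompactSVD (CFC.sqrt (Ω * diagonal lam * Ωᵀ) * candidate Ω (diagonal lam) J hJ V)
      (columns Ω J hJ) (lam ∘ J.orderEmbOfFin hJ) V where
  left_orthonormal := columns_transpose_mul_columns hΩ hJ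
  right_orthonormal := hV
  pos _ := hpos _
  eq := by
    rw [candidate_eq_sqrt_mul hΩ hpos, ← Matrix.mul_assoc, ← Matrix.mul_assoc,
      sqrt_mul_sqrt_self (posDef_conj_diagonal hΩ hpos).posSemidef, columns,
      conj_diagonal_mul_submatrix hΩ]

theorem candidate_mem_rankEq (hΩ : Ωᵀ * Ω = 1) (hpos : ∀ i, 0 < lam i) (hJ : J.card = k)
    {V : Matrix (Fin m) (Fin k) ℝ} (hV : Vᵀ * V = 1) :
    candidate Ω (diagonal lam) J hJ V ∈ rankEq k n m := by
  rw [rankEq, Set.mem_ofPred_eq, ← rank_sqrt_mul (posDef_conj_diagonal hΩ hpos),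
    (isCompactSVD_sqrt_mul_candidate hΩ hpos hJ hV).rank_eq, Fintype.card_fin]

theorem exists_eq_candidate {ι : Type*} [Fintype ι] [DecidableEq ι] {U : Matrix (Fin n) ι ℝ}
    {V : Matrix (Fin m) ι ℝ} (hΩ : Ωᵀ * Ω = 1) (hpos : ∀ i, 0 < lam i) (hJ : J.card = k)
    (hU : Uᵀ * U = 1) (hV : Vᵀ * V = 1)
    (hproj : Ωᵀ * U * (Ωᵀ * U)ᵀ = diagonal ((J : Set (Fin n)).indicator 1)) :
    ∃ V' : Matrix (Fin m) (Fin k) ℝ, V'ᵀ * V' = 1 ∧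
      CFC.sqrt (Ω * diagonal lam * Ωᵀ) * U * Vᵀ = candidate Ω (diagonal lam) J hJ V' := by
  set C := columns Ω J hJ
  have hΩt : Ω * Ωᵀ = 1 := mul_eq_one_comm.mp hΩ
  have hrange : U * Uᵀ = C * Cᵀ := by
    calc U * Uᵀ = Ω * Ωᵀ * (U * Uᵀ) * (Ω * Ωᵀ) := by rw [hΩt, Matrix.one_mul, Matrix.mul_one]
      _ = Ω * (Ωᵀ * U * (Ωᵀ * U)ᵀ) * Ωᵀ := by
          simp only [transpose_mul, transpose_transpose, Matrix.mul_assoc]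
      _ = C * Cᵀ := by rw [hproj, columns_mul_transpose]
  have hC : Cᵀ * C = 1 := columns_transpose_mul_columns hΩ hJ
  have hrotation : C * (Cᵀ * U) = U := by
    rw [← Matrix.mul_assoc, ← hrange, Matrix.mul_assoc, hU, Matrix.mul_one]
  have hrotation_mul_transpose : Cᵀ * U * (Cᵀ * U)ᵀ = 1 := by
    calc Cᵀ * U * (Cᵀ * U)ᵀ = Cᵀ * (U * Uᵀ) * C := by
          simp only [transpose_mul, transpose_transpose, Matrix.mul_assoc]
      _ = Cᵀ * C * (Cᵀ * C) := by rw [hrange]; simp only [Matrix.mul_assoc]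
      _ = 1 := by rw [hC, Matrix.mul_one]
  refine ⟨V * (Cᵀ * U)ᵀ,
    transpose_mul_self_mul hV (by rwa [transpose_transpose]), ?_⟩
  calc CFC.sqrt (Ω * diagonal lam * Ωᵀ) * U * Vᵀ
      = CFC.sqrt (Ω * diagonal lam * Ωᵀ) * C * (V * (Cᵀ * U)ᵀ)ᵀ := by
        rw [transpose_mul V, transpose_transpose, Matrix.mul_assoc _ C, ← Matrix.mul_assoc C,
          hrotation, Matrix.mul_assoc]
    _ = candidate Ω (diagonal lam) J hJ (V * (Cᵀ * U)ᵀ) :=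
        (candidate_eq_sqrt_mul hΩ hpos hJ _).symm

theorem isCriticalPointOn_lossOne_iff_exists_eq_candidate (hΩ : Ωᵀ * Ω = 1)
    (hlam : Function.Injective lam) (hpos : ∀ i, 0 < lam i) {W : Matrix (Fin n) (Fin m) ℝ} :
    IsCriticalPointOn (lossOne (Ω * diagonal lam * Ωᵀ)) (rankEq k n m) W ↔
      ∃ (J : Finset (Fin n)) (hJ : J.card = k) (V : Matrix (Fin m) (Fin k) ℝ),
        Vᵀ * V = 1 ∧ W = candidate Ω (diagonal lam) J hJ V := by
  have hS := posDef_conj_diagonal hΩ hpos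
  constructor
  · intro hcrit
    obtain ⟨U, s, V, h⟩ := exists_isCompactSVD ((rank_sqrt_mul hS W).trans hcrit.1)
    have hW := (isCriticalPointOn_lossOne_iff hS h).mp (by rwa [Fintype.card_fin])
    have horth := transpose_mul_orthonormal hΩ h.left_orthonormal
    obtain ⟨J, hproj⟩ := exists_eq_diagonal_indicator_of_commute
      (isStarProjection_mul_transpose horth) hlam (commute_diagonal_of_commute_conj hΩ
        (commute_mul_transpose_of_eq_sqrt_mul hS.posSemidef h hW))
    have hJ : J.card = k := by
      have htrace := trace_diagonal_indicator J
      rw [← hproj, trace_mul_comm, horth, trace_one, Fintype.card_fin] at htrace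
      exact_mod_cast htrace.symm
    obtain ⟨V', hV', hcandidate⟩ :=
      exists_eq_candidate hΩ hpos hJ h.left_orthonormal h.right_orthonormal hproj
    exact ⟨J, hJ, V', hV', hW.trans hcandidate⟩
  · rintro ⟨J, hJ, V, hV, rfl⟩
    simpa using (isCriticalPointOn_lossOne_iff hS
      (isCompactSVD_sqrt_mul_candidate hΩ hpos hJ hV)).mpr (candidate_eq_sqrt_mul hΩ hpos hJ V)

theorem lossOne_candidate (hΩ : Ωᵀ * Ω = 1) (hpos : ∀ i, 0 < lam i) (hJ : J.card = k)
    {V : Matrix (Fin m) (Fin k) ℝ} (hV : Vᵀ * V = 1) :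
    lossOne (Ω * diagonal lam * Ωᵀ) (candidate Ω (diagonal lam) J hJ V) = ∑ i ∈ Jᶜ, lam i := by
  rw [lossOne_eq_frobeniusSq_add (posDef_conj_diagonal hΩ hpos).posSemidef
      (isCompactSVD_sqrt_mul_candidate hΩ hpos hJ hV), ← candidate_eq_sqrt_mul hΩ hpos, sub_self,
    frobeniusSq_eq_zero_iff.mpr rfl, trace_conj_diagonal hΩ, trace_transpose_conj_diagonal,
    transpose_mul_columns_mul_transpose hΩ, ← Finset.sum_add_sum_compl J lam]
  simp [Set.indicator_apply]

end Candidates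

section Minimizers

variable {n m k : ℕ} {Ω : Matrix (Fin n) (Fin n) ℝ} {lam : Fin n → ℝ} {J T : Finset (Fin n)}

theorem exists_eq_candidate_of_lossOne_le (hΩ : Ωᵀ * Ω = 1) (hpos : ∀ i, 0 < lam i)
    (hT : T.card = k) (htop : ∀ i ∈ T, ∀ j ∉ T, lam j < lam i) {W : Matrix (Fin n) (Fin m) ℝ}
    (hW : W ∈ rankLE k n m) (hle : lossOne (Ω * diagonal lam * Ωᵀ) W ≤ ∑ i ∈ Tᶜ, lam i) :
    ∃ V : Matrix (Fin m) (Fin k) ℝ, Vᵀ * V = 1 ∧ W = candidate Ω (diagonal lam) T hT V := by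
  have hS := posDef_conj_diagonal hΩ hpos
  obtain ⟨U, s, V, h⟩ := exists_isCompactSVD (rank_sqrt_mul hS W)
  have horth := transpose_mul_orthonormal hΩ h.left_orthonormal
  have hproj := isStarProjection_mul_transpose horth
  have hcard : ∑ i, (Ωᵀ * U * (Ωᵀ * U)ᵀ) i i ≤ T.card := by
    change (Ωᵀ * U * (Ωᵀ * U)ᵀ).trace ≤ T.card
    rw [trace_mul_comm, horth, trace_one, Fintype.card_fin, hT]
    exact_mod_cast hW
  have hsplit := Finset.sum_add_sum_compl T lam
  rw [lossOne_eq_frobeniusSq_add hS.posSemidef h, trace_conj_diagonal hΩ,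
    trace_transpose_conj_diagonal] at hle
  have hresidual := frobeniusSq_nonneg (W - CFC.sqrt (Ω * diagonal lam * Ωᵀ) * U * Vᵀ)
  have hdiag : (Ωᵀ * U * (Ωᵀ * U)ᵀ).diag = (T : Set (Fin n)).indicator 1 :=
    eq_indicator_of_sum_le_sum_mul (fun i _ => hpos i) htop
      (fun i => diag_nonneg_of_isStarProjection hproj i)
      (fun i => diag_le_one_of_isStarProjection hproj i) hcard (by simp only [diag_apply]; linarith)
  have hproj_eq := eq_diagonal_indicator_of_isStarProjection hproj hdiag
  have hvalue : ∑ i, lam i * (Ωᵀ * U * (Ωᵀ * U)ᵀ) i i = ∑ i ∈ T, lam i := by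
    rw [hproj_eq]
    simp [Set.indicator_apply]
  have hW_eq : W = CFC.sqrt (Ω * diagonal lam * Ωᵀ) * U * Vᵀ :=
    sub_eq_zero.mp (frobeniusSq_eq_zero_iff.mp (le_antisymm (by linarith) hresidual))
  rw [hW_eq]
  exact exists_eq_candidate hΩ hpos hT h.left_orthonormal h.right_orthonormal hproj_eq

theorem sum_compl_le_lossOne (hΩ : Ωᵀ * Ω = 1) (hpos : ∀ i, 0 < lam i) (hT : T.card = k)
    (htop : ∀ i ∈ T, ∀ j ∉ T, lam j < lam i) {W : Matrix (Fin n) (Fin m) ℝ}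
    (hW : W ∈ rankLE k n m) : ∑ i ∈ Tᶜ, lam i ≤ lossOne (Ω * diagonal lam * Ωᵀ) W := by
  by_contra! hlt
  obtain ⟨V, hV, rfl⟩ := exists_eq_candidate_of_lossOne_le hΩ hpos hT htop hW hlt.le
  exact hlt.ne (lossOne_candidate hΩ hpos hT hV)

theorem isMinOn_candidate (hΩ : Ωᵀ * Ω = 1) (hpos : ∀ i, 0 < lam i) (hT : T.card = k)
    (htop : ∀ i ∈ T, ∀ j ∉ T, lam j < lam i) {V : Matrix (Fin m) (Fin k) ℝ} (hV : Vᵀ * V = 1) :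
    IsMinOn (lossOne (Ω * diagonal lam * Ωᵀ)) (rankLE k n m)
      (candidate Ω (diagonal lam) T hT V) :=
  isMinOn_iff.mpr fun _ hW =>
    (lossOne_candidate hΩ hpos hT hV).trans_le (sum_compl_le_lossOne hΩ hpos hT htop hW)

theorem rankEq_subset_rankLE (k n m : ℕ) : rankEq k n m ⊆ rankLE k n m := fun _ => le_of_eq

theorem isMinOn_candidate_iff (hΩ : Ωᵀ * Ω = 1) (hpos : ∀ i, 0 < lam i) (hT : T.card = k)
    (htop : ∀ i ∈ T, ∀ j ∉ T, lam j < lam i) (hJ : J.card = k) {V : Matrix (Fin m) (Fin k) ℝ}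
    (hV : Vᵀ * V = 1) :
    IsMinOn (lossOne (Ω * diagonal lam * Ωᵀ)) (rankLE k n m)
      (candidate Ω (diagonal lam) J hJ V) ↔ J = T := by
  refine ⟨fun hmin => ?_, fun hJT => ?_⟩
  · have hle := isMinOn_iff.mp hmin _
      (rankEq_subset_rankLE k n m (candidate_mem_rankEq hΩ hpos hT hV))
    rw [lossOne_candidate hΩ hpos hJ hV, lossOne_candidate hΩ hpos hT hV] at hle
    have hsum : ∑ i ∈ T, lam i ≤ ∑ i, lam i * (J : Set (Fin n)).indicator 1 i := by
      have hvalue : ∑ i, lam i * (J : Set (Fin n)).indicator 1 i = ∑ i ∈ J, lam i := by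
        simp [Set.indicator_apply]
      linarith [Finset.sum_add_sum_compl T lam, Finset.sum_add_sum_compl J lam]
    have hind : (J : Set (Fin n)).indicator (1 : Fin n → ℝ) = (T : Set (Fin n)).indicator 1 :=
      eq_indicator_of_sum_le_sum_mul (fun i _ => hpos i) htop
        (fun i => Set.indicator_nonneg (fun _ _ => zero_le_one) i)
        (fun i => Set.indicator_le_self' (fun _ _ => zero_le_one) i)
        (by simp [Set.indicator_apply, hJ, hT]) hsum
    exact Finset.coe_injective (Set.indicator_one_inj ℝ hind)
  · subst hJT
    exact isMinOn_candidate hΩ hpos hJ htop hV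

theorem exists_orthonormal_columns (hkm : k ≤ m) :
    ∃ V : Matrix (Fin m) (Fin k) ℝ, Vᵀ * V = 1 :=
  ⟨(1 : Matrix (Fin m) (Fin m) ℝ).submatrix id (Fin.castLE hkm),
    submatrix_transpose_mul_submatrix (by simp) (Fin.castLE_injective hkm)⟩

theorem isLeast_lossOne_image (hΩ : Ωᵀ * Ω = 1) (hpos : ∀ i, 0 < lam i) (hkm : k ≤ m)
    (hT : T.card = k) (htop : ∀ i ∈ T, ∀ j ∉ T, lam j < lam i)
    {M : Set (Matrix (Fin n) (Fin m) ℝ)} (hEq : rankEq k n m ⊆ M) (hLE : M ⊆ rankLE k n m) :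
    IsLeast (lossOne (Ω * diagonal lam * Ωᵀ) '' M) (∑ i ∈ Tᶜ, lam i) := by
  obtain ⟨V, hV⟩ := exists_orthonormal_columns hkm
  refine ⟨⟨_, hEq (candidate_mem_rankEq hΩ hpos hT hV), lossOne_candidate hΩ hpos hT hV⟩, ?_⟩
  rintro _ ⟨W, hW, rfl⟩
  exact sum_compl_le_lossOne hΩ hpos hT htop (hLE hW)

theorem isMinOn_lossOne_iff_exists_eq_candidate (hΩ : Ωᵀ * Ω = 1) (hpos : ∀ i, 0 < lam i)
    (hkm : k ≤ m) (hT : T.card = k) (htop : ∀ i ∈ T, ∀ j ∉ T, lam j < lam i)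
    {W : Matrix (Fin n) (Fin m) ℝ} :
    (W ∈ rankLE k n m ∧ IsMinOn (lossOne (Ω * diagonal lam * Ωᵀ)) (rankLE k n m) W) ↔
      ∃ V : Matrix (Fin m) (Fin k) ℝ, Vᵀ * V = 1 ∧ W = candidate Ω (diagonal lam) T hT V := by
  constructor
  · rintro ⟨hW, hmin⟩
    obtain ⟨W₀, hW₀, hvalue⟩ :=
      (isLeast_lossOne_image hΩ hpos hkm hT htop (rankEq_subset_rankLE k n m) subset_rfl).1
    exact exists_eq_candidate_of_lossOne_le hΩ hpos hT htop hW
      ((isMinOn_iff.mp hmin W₀ hW₀).trans_eq hvalue)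
  · rintro ⟨V, hV, rfl⟩
    exact ⟨rankEq_subset_rankLE k n m (candidate_mem_rankEq hΩ hpos hT hV),
      isMinOn_candidate hΩ hpos hT htop hV⟩

theorem lt_of_mem_firstIndices_of_notMem (hlam : StrictAnti lam) :
    ∀ i ∈ firstIndices n k, ∀ j ∉ firstIndices n k, lam j < lam i := by
  intro i hi j hj
  simp only [firstIndices, Finset.mem_filter, Finset.mem_univ, true_and, not_lt] at hi hj
  exact hlam (hi.trans_le hj)

end Minimizers

end BuresWasserstein

open BuresWasserstein in
theorem mainTheorem1 {n m k : ℕ} (hk : 1 ≤ k) (hkn : k ≤ n) (hkm : k ≤ m)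
    (S₀ Ω : Matrix (Fin n) (Fin n) ℝ) (lam : Fin n → ℝ)
    (hΩ : Ω ∈ Matrix.orthogonalGroup (Fin n) ℝ)
    (hlam : StrictAnti lam) (hpos : ∀ i, 0 < lam i)
    (hS₀ : S₀ = Ω * Matrix.diagonal lam * Ωᵀ) :
    -- the restriction of the loss to the rank-`k` matrices is differentiable
    DifferentiableOn ℝ (lossOne S₀) (rankEq k n m) ∧
    -- its critical points
    (∀ W : Matrix (Fin n) (Fin m) ℝ,
      IsCriticalPointOn (lossOne S₀) (rankEq k n m) W ↔
        ∃ (J : Finset (Fin n)) (hJ : J.card = k) (V : Matrix (Fin m) (Fin k) ℝ),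
          Vᵀ * V = 1 ∧ W = candidate Ω (Matrix.diagonal lam) J hJ V) ∧
    -- a critical point is a minimizer over rank at most `k` precisely when its index set is `[k]`
    (∀ (J : Finset (Fin n)) (hJ : J.card = k) (V : Matrix (Fin m) (Fin k) ℝ), Vᵀ * V = 1 →
      (IsMinOn (lossOne S₀) (rankLE k n m) (candidate Ω (Matrix.diagonal lam) J hJ V) ↔
        J = firstIndices n k)) ∧
    -- and these are all the minimizers over rank at most `k`
    (∀ W : Matrix (Fin n) (Fin m) ℝ,
      (W ∈ rankLE k n m ∧ IsMinOn (lossOne S₀) (rankLE k n m) W) ↔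
        ∃ V : Matrix (Fin m) (Fin k) ℝ, Vᵀ * V = 1 ∧
          W = candidate Ω (Matrix.diagonal lam) (firstIndices n k) (card_firstIndices hkn) V) ∧
    -- the infimum over rank `k` is a minimum, equal to the minimum over rank at most `k`
    (∃ c : ℝ, IsGLB (lossOne S₀ '' rankEq k n m) c ∧ IsLeast (lossOne S₀ '' rankEq k n m) c ∧
      IsLeast (lossOne S₀ '' rankLE k n m) c) := by
  subst hS₀
  have hΩ' : Ωᵀ * Ω = 1 := (Matrix.mem_orthogonalGroup_iff' (Fin n) ℝ).mp hΩ
  have htop := lt_of_mem_firstIndices_of_notMem (k := k) hlam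
  have hT := card_firstIndices hkn
  have hsub := rankEq_subset_rankLE k n m
  have hleast := isLeast_lossOne_image hΩ' hpos hkm hT htop subset_rfl hsub
  exact ⟨differentiableOn_lossOne (posDef_conj_diagonal hΩ' hpos) k,
    fun W => isCriticalPointOn_lossOne_iff_exists_eq_candidate hΩ' hlam.injective hpos,
    fun J hJ V hV => isMinOn_candidate_iff hΩ' hpos hT htop hJ hV,
    fun W => isMinOn_lossOne_iff_exists_eq_candidate hΩ' hpos hkm hT htop,
    _, hleast.isGLB, hleast, isLeast_lossOne_image hΩ' hpos hkm hT htop hsub subset_rfl⟩
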